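/- Let $d\in\{1,2\}$, let $M,C,S,N$ be positive integers and $k=2r+1$ an odd positive integer with $SN\ge 2k-1$. Let $\mathbf K=(\mathbf K_{m,c,p})$ be a real kernel tensor, with $m\in\{1,\dots,M\}$ (output channels), $c\in\{1,\dots,C\}$ (input channels) and $p\in\{0,\dots,k-1\}^d$. Let $\mathcal K\in\mathbb R^{MN^d\times C(SN)^d}$ be the matrix of the convolutional layer with kernel $\mathbf K$, stride $S$ and circular boundary conditions: it maps $x=(x_{c,u})$, $u\in\{0,\dots,SN-1\}^d$, to $$y_{m,i}=\sum_{c=1}^{C}\ \sum_{p\in\{0,\dots,k-1\}^d}\mathbf K_{m,c,p}\,x_{c,\,(Si+p-(r,\dots,r))\bmod SN},\qquad i\in\{0,\dots,N-1\}^d .$$ Put $q=\lfloor (k-1)/S\rfloor$, $P=qS$, and for $m,l\in\{1,\dots,M\}$, $i\in\{0,\dots,2q\}^d$, $$T_{m,l,i}=\sum_{c=1}^{C}\ \sum_{p\in\{0,\dots,k-1\}^d}\mathbf K_{m,c,p}\,\mathbf K_{l,c,\,Si+p-(P,\dots,P)},$$ where $\mathbf K_{l,c,u}=0$ if $u\notin\{0,\dots,k-1\}^d$.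 Let $I_{m,l,i}=1$ if $m=l$ and $i=(q,\dots,q)$, and $I_{m,l,i}=0$ otherwise. Define $L_{orth}(\mathbf K)$ and the spectral norm $\mathrm{err}^s_N(\mathbf K)$ of the orthogonality residual by * RO case ($M\le CS^d$): $L_{orth}(\mathbf K)=\sum_{m,l,i}(T_{m,l,i}-I_{m,l,i})^2$ and $\mathrm{err}^s_N(\mathbf K)=\|\mathcal K\mathcal K^{T}-\mathrm{Id}\|_2$; * CO case ($M\ge CS^d$): $L_{orth}(\mathbf K)=\sum_{m,l,i}(T_{m,l,i}-I_{m,l,i})^2-(M-CS^d)$ and $\mathrm{err}^s_N(\mathbf K)=\|\mathcal K^{T}\mathcal K-\mathrm{Id}\|_2$. Then, in each case (and in both of them when $M=CS^d$), $$\frac{1}{\min(M,CS^2)}\,L_{orth}(\mathbf K)\ \le\ \bigl(\mathrm{err}^s_N(\mathbf K)\bigr)^2\ \le\ \alpha\,L_{orth}(\mathbf K),$$ where $\alpha=\bigl(2\lfloor (k-1)/S\rfloor+1\bigr)^d M$ in the RO case and $\alpha=(2k-1)^d\,C$ in the CO case. In particular, neither constant depends on $N$. -/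

import Mathlib

namespace ConvOrth

/-- Kernel tensors: `M` output channels, `C` input channels, spatial support `k` in each of the
`d` dimensions, i.e. `ℝ^{M × C × k}` for `d = 1` and `ℝ^{M × C × k × k}` for `d = 2`.
All indices start at `0`. -/
abbrev Kernel (d M C k : ℕ) : Type := Fin M → Fin C → (Fin d → Fin k) → ℝ

/-- The layer transform matrix of the `S`-strided convolutional layer with kernel `K` and circular
boundary conditions. The columns are indexed by (input channel, position in `⟦0, SN - 1⟧^d`), the
rows by (output channel, position in `⟦0, N - 1⟧^d`). The kernel is centred (`k = 2 r + 1`) and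
not flipped: in output channel `m`, at position `i`, the output is
`∑ c, ∑ p, K m c p * x c ((S i + p - r) % (S N))`, see `layerMatrix_mulVec`. -/
def layerMatrix {d M C k : ℕ} (S N : ℕ) (K : Kernel d M C k) :
    Matrix (Fin M × (Fin d → Fin N)) (Fin C × (Fin d → Fin (S * N))) ℝ :=
  Matrix.of fun mi cj =>
    ∑ p : Fin d → Fin k,
      if ∀ a, ((S : ℤ) * (mi.2 a : ℕ) + (p a : ℕ) - ((k - 1) / 2 : ℕ)) % ((S * N : ℕ) : ℤ)
          = ((cj.2 a : ℕ) : ℤ)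
      then K mi.1 cj.1 p else 0

/-- Applying the layer transform matrix to the (vectorized) input `x` computes the circular
strided convolution. -/
theorem layerMatrix_mulVec {d M C k S N : ℕ} (hSN : 0 < S * N) (K : Kernel d M C k)
    (x : Fin C → (Fin d → ℤ) → ℝ) (m : Fin M) (i : Fin d → Fin N) :
    (layerMatrix S N K).mulVec (fun cj => x cj.1 (fun a => ((cj.2 a : ℕ) : ℤ))) (m, i)
      = ∑ c : Fin C, ∑ p : Fin d → Fin k, K m c p *
          x c (fun a => ((S : ℤ) * (i a : ℕ) + (p a : ℕ) - ((k - 1) / 2 : ℕ))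
            % ((S * N : ℕ) : ℤ)) := by
  simp only [Matrix.mulVec, dotProduct, layerMatrix, Matrix.of_apply, Fintype.sum_prod_type]
  refine Finset.sum_congr rfl fun c _ => ?_
  simp only [Finset.sum_mul, ite_mul, zero_mul]
  rw [Finset.sum_comm]
  refine Finset.sum_congr rfl fun p _ => ?_
  have hpos : (0 : ℤ) < ((S * N : ℕ) : ℤ) := by exact_mod_cast hSN
  set z : Fin d → ℤ := fun a => ((S : ℤ) * (i a : ℕ) + (p a : ℕ) - ((k - 1) / 2 : ℕ))
            % ((S * N : ℕ) : ℤ) with hz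
  have h0 : ∀ a, 0 ≤ z a := fun a => Int.emod_nonneg _ hpos.ne'
  have h1 : ∀ a, z a < ((S * N : ℕ) : ℤ) := fun a => Int.emod_lt_of_pos _ hpos
  let w : Fin d → Fin (S * N) := fun a => ⟨(z a).toNat, by
    have := h0 a; have := h1 a; omega⟩
  have hw : ∀ a, ((w a : ℕ) : ℤ) = z a := fun a => Int.toNat_of_nonneg (h0 a)
  rw [Finset.sum_eq_single w]
  · rw [if_pos fun a => (hw a).symm]
    congr 2
    exact funext hw
  · intro j _ hj
    refine if_neg fun h => hj (funext fun a => Fin.ext ?_)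
    have h2 := h a
    have h3 := hw a
    simp only [hz] at h3
    rw [← h3] at h2
    exact_mod_cast h2.symm
  · simp

/-- The zero-padding `ḡ` of `g`: entry `i` is `g (i - P)` if `i ∈ ⟦P, P + k - 1⟧^d`, else `0`. -/
def zeroPad {d k : ℕ} (P : ℕ) (g : (Fin d → Fin k) → ℝ) (i : Fin d → ℕ) : ℝ :=
  if h : ∀ a, P ≤ i a ∧ i a < P + k then
    g (fun a => ⟨i a - P, by have := h a; omega⟩)
  else 0

/-- `conv(h, g, padding zero = P, stride = S)`, a tensor of side `⌊2P/S⌋ + 1`. -/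
def conv {d k : ℕ} (P S : ℕ) (h g : (Fin d → Fin k) → ℝ) (i : Fin d → Fin (2 * P / S + 1)) : ℝ :=
  ∑ p : Fin d → Fin k, h p * zeroPad P g (fun a => S * (i a : ℕ) + (p a : ℕ))

/-- `CONV(K, K, padding zero = P, stride = S)`. -/
def convTensor {d M C k : ℕ} (P S : ℕ) (K : Kernel d M C k) (m l : Fin M)
    (i : Fin d → Fin (2 * P / S + 1)) : ℝ :=
  ∑ c : Fin C, conv P S (K m c) (K l c) i

/-- `I_{r0}`: the tensor whose only non-zero part is the identity matrix at the centre. -/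
def idTensor {d : ℕ} (M P S : ℕ) (m l : Fin M) (i : Fin d → Fin (2 * P / S + 1)) : ℝ :=
  if m = l ∧ ∀ a, (i a : ℕ) = P / S then 1 else 0

/-- The padding parameter `P = ⌊(k - 1) / S⌋ S`. -/
def padding (k S : ℕ) : ℕ := (k - 1) / S * S

/-- `L_orth` in the RO case (`M ≤ C S^d`): the squared Frobenius norm of `CONV(K, K) - I_{r0}`. -/
def LorthRO {d M C k : ℕ} (S : ℕ) (K : Kernel d M C k) : ℝ :=
  ∑ m : Fin M, ∑ l : Fin M, ∑ i : Fin d → Fin (2 * padding k S / S + 1),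
    (convTensor (padding k S) S K m l i - idTensor M (padding k S) S m l i) ^ 2

/-- `L_orth` in the CO case (`M ≥ C S^d`). -/
def LorthCO {d M C k : ℕ} (S : ℕ) (K : Kernel d M C k) : ℝ :=
  LorthRO S K - ((M : ℝ) - (C : ℝ) * (S : ℝ) ^ d)

/-- The spectral norm of a square real matrix: its operator norm for Euclidean norms. -/
noncomputable def specNorm {n : Type*} [Fintype n] [DecidableEq n] (A : Matrix n n ℝ) : ℝ :=
  ‖Matrix.toEuclideanCLM (n := n) (𝕜 := ℝ) A‖

/-- Spectral norm of the orthogonality residual in the RO case, `‖𝒦 𝒦ᵀ - Id‖₂`. -/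
noncomputable def errSpecRO {d M C k : ℕ} (S N : ℕ) (K : Kernel d M C k) : ℝ :=
  specNorm (layerMatrix S N K * (layerMatrix S N K).transpose - 1)

/-- Spectral norm of the orthogonality residual in the CO case, `‖𝒦ᵀ 𝒦 - Id‖₂`. -/
noncomputable def errSpecCO {d M C k : ℕ} (S N : ℕ) (K : Kernel d M C k) : ℝ :=
  specNorm ((layerMatrix S N K).transpose * layerMatrix S N K - 1)

end ConvOrth

/-!
Write `A` for the layer matrix. It commutes with translations: translating the output positions by
`t` and the input positions by `S t` leaves it unchanged (`layerMatrix_submatrix_shift`), so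
`R = A Aᵀ - 1` is invariant under all translations and `Q = Aᵀ A - 1` under translations by
multiples of `S`.

The column of `R` at the output position `(q, …, q)`, `q = ⌊(k - 1) / S⌋`, is the tensor
`CONV(K, K) - I_{r0}` extended by zero; the hypothesis `2 k - 1 ≤ S N` is what excludes
wrap-around there (`layerMatrix_gram_apply`, `sum_residual_sq`). By translation invariance the same
values make up every column of `R`, hence `‖R‖_F² = N ^ d · LorthRO` (`sum_residual_sq_eq`). Since
`‖Aᵀ A - 1‖_F²` and `‖A Aᵀ - 1‖_F²` differ by the difference of the two dimensions, also
`‖Q‖_F² = N ^ d · LorthCO` (`sum_coresidual_sq_eq`).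

Both bounds compare the spectral norm with squared column norms. A column has Euclidean norm at
most the spectral norm (`sum_sq_col_le_specNorm_sq`), which gives the lower bounds. Conversely, the
Schur test and the Cauchy–Schwarz inequality bound the squared spectral norm of a symmetric matrix
by the maximal number of non-zero entries of a column times the maximal squared norm of a column
(`specNorm_sq_le`). A column of `R` has at most `(2 q + 1) ^ d M` non-zero entries, and a column of
`Q` at most `(2 k - 1) ^ d C`. A squared column norm is at most `LorthRO` for `R`, and at most
`LorthCO` for `Q`, because each column of `Q` has `N ^ d` distinct translates of the same norm.
-/

namespace ConvOrth

/-! ### Spectral norm, columns and Frobenius norm -/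

theorem sum_sq_col_le_specNorm_sq {n : Type*} [Fintype n] [DecidableEq n] (A : Matrix n n ℝ)
    (j : n) : ∑ i, A i j ^ 2 ≤ specNorm A ^ 2 := by
  have h := (Matrix.toEuclideanCLM (n := n) (𝕜 := ℝ) A).le_opNorm (EuclideanSpace.single j 1)
  rw [PiLp.norm_single, norm_one, mul_one] at h
  have h2 := pow_le_pow_left₀ (norm_nonneg _) h 2
  rw [EuclideanSpace.norm_sq_eq] at h2
  refine le_trans (le_of_eq ?_) h2
  refine Finset.sum_congr rfl fun i _ => ?_
  rw [Matrix.ofLp_toEuclideanCLM]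
  simp

/-- The Schur test for a symmetric matrix. -/
theorem specNorm_le_of_sum_abs_le {n : Type*} [Fintype n] [DecidableEq n] {A : Matrix n n ℝ}
    (hA : A.IsSymm) {b : ℝ} (hb : 0 ≤ b) (h : ∀ j, ∑ i, |A i j| ≤ b) : specNorm A ≤ b := by
  refine ContinuousLinearMap.opNorm_le_bound _ hb fun x => ?_
  refine le_of_sq_le_sq ?_ (by positivity)
  rw [mul_pow, EuclideanSpace.norm_sq_eq, EuclideanSpace.norm_sq_eq]
  have hrow : ∀ i, ∑ j, |A i j| ≤ b := fun i => by
    refine le_trans (le_of_eq ?_) (h i)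
    exact Finset.sum_congr rfl fun j _ => by rw [hA.apply]
  calc ∑ i, ‖(Matrix.toEuclideanCLM (n := n) (𝕜 := ℝ) A x) i‖ ^ 2
      ≤ ∑ i, b * ∑ j, |A i j| * x j ^ 2 := Finset.sum_le_sum fun i _ => by
        rw [Matrix.ofLp_toEuclideanCLM, Real.norm_eq_abs, sq_abs]
        refine le_trans ?_ (mul_le_mul_of_nonneg_right (hrow i)
          (Finset.sum_nonneg fun j _ => by positivity))
        refine Finset.sum_sq_le_sum_mul_sum_of_sq_le_mul _ (fun j _ => abs_nonneg _)
          (fun j _ => by positivity) fun j _ => le_of_eq ?_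
        rw [mul_pow, ← sq_abs (A i j)]
        ring
    _ = b * ∑ j, (∑ i, |A i j|) * x j ^ 2 := by
        rw [← Finset.mul_sum, Finset.sum_comm]
        simp only [Finset.sum_mul]
    _ ≤ b * ∑ j, b * x j ^ 2 := by
        gcongr with j
        exact h j
    _ = b ^ 2 * ∑ j, ‖x j‖ ^ 2 := by
        simp only [← Finset.mul_sum, Real.norm_eq_abs, sq_abs]
        ring

theorem specNorm_sq_le {n : Type*} [Fintype n] [DecidableEq n] {A : Matrix n n ℝ}
    (hA : A.IsSymm) {s : ℕ} {L : ℝ} (hL : 0 ≤ L)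
    (hs : ∀ j, (Finset.univ.filter fun i => A i j ≠ 0).card ≤ s)
    (h : ∀ j, ∑ i, A i j ^ 2 ≤ L) : specNorm A ^ 2 ≤ s * L := by
  have hb : specNorm A ≤ √(s * L) := by
    refine specNorm_le_of_sum_abs_le hA (Real.sqrt_nonneg _) fun j => Real.le_sqrt_of_sq_le ?_
    have h1 : ∑ i, |A i j| = ∑ i with A i j ≠ 0, |A i j| := by
      refine (Finset.sum_subset (Finset.subset_univ _) fun i _ hi => ?_).symm
      simpa using hi
    calc (∑ i, |A i j|) ^ 2
        ≤ (Finset.univ.filter fun i => A i j ≠ 0).card * ∑ i with A i j ≠ 0, |A i j| ^ 2 := by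
          rw [h1]
          exact sq_sum_le_card_mul_sum_sq
      _ ≤ s * L := by
          gcongr
          · exact hs j
          · refine le_trans ?_ (h j)
            simp only [sq_abs]
            exact Finset.sum_le_sum_of_subset_of_nonneg (Finset.subset_univ _)
              fun i _ _ => sq_nonneg _
  calc specNorm A ^ 2 ≤ √(s * L) ^ 2 := pow_le_pow_left₀ (norm_nonneg _) hb 2
    _ = s * L := Real.sq_sqrt (by positivity)

theorem isSymm_mul_transpose_sub_one {m n : Type*} [Fintype n] [DecidableEq m]
    (A : Matrix m n ℝ) : (A * A.transpose - 1).IsSymm := by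
  simp [Matrix.IsSymm, Matrix.transpose_sub, Matrix.transpose_mul]

theorem sum_sq_eq_trace {n : Type*} [Fintype n] {B : Matrix n n ℝ} (hB : B.IsSymm) :
    ∑ j, ∑ i, B i j ^ 2 = (B * B).trace := by
  simp only [Matrix.trace, Matrix.diag, Matrix.mul_apply]
  refine Finset.sum_congr rfl fun j _ => Finset.sum_congr rfl fun i _ => ?_
  rw [sq, hB.apply i j]

/-- The squared Frobenius norms of `Aᵀ A - 1` and of `A Aᵀ - 1` differ by the difference of the
dimensions. -/
theorem sum_sq_transpose_mul_sub_one {m n : Type*} [Fintype m] [Fintype n] [DecidableEq m]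
    [DecidableEq n] (A : Matrix m n ℝ) :
    ∑ j, ∑ i, (A.transpose * A - 1 : Matrix n n ℝ) i j ^ 2
      = ∑ j, ∑ i, (A * A.transpose - 1 : Matrix m m ℝ) i j ^ 2
        - ((Fintype.card m : ℝ) - Fintype.card n) := by
  have h := isSymm_mul_transpose_sub_one A.transpose
  rw [Matrix.transpose_transpose] at h
  rw [sum_sq_eq_trace h, sum_sq_eq_trace (isSymm_mul_transpose_sub_one A)]
  have h2 : (A.transpose * A * (A.transpose * A)).trace
      = (A * A.transpose * (A * A.transpose)).trace := by
    rw [Matrix.mul_assoc, Matrix.trace_mul_comm]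
    simp only [Matrix.mul_assoc]
  simp only [sub_mul, mul_sub, Matrix.trace_sub, mul_one, one_mul, Matrix.trace_one, h2,
    Matrix.trace_mul_comm A.transpose A]
  ring

/-! ### Translation invariance -/

/-- Translation of the output positions by `t`, modulo `N`. -/
def outShift {d : ℕ} (M : ℕ) {N : ℕ} [NeZero N] (t : Fin d → Fin N) :
    Fin M × (Fin d → Fin N) ≃ Fin M × (Fin d → Fin N) :=
  Equiv.prodCongr (Equiv.refl _) (Equiv.addRight t)

/-- Translation of the input positions by `S t`, modulo `S N`. -/
def inShift {d : ℕ} (C S : ℕ) {N : ℕ} [NeZero (S * N)] (t : Fin d → Fin N) :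
    Fin C × (Fin d → Fin (S * N)) ≃ Fin C × (Fin d → Fin (S * N)) :=
  Equiv.prodCongr (Equiv.refl _) (Equiv.addRight fun a => Fin.ofNat (S * N) (S * (t a : ℕ)))

theorem emod_eq_iff_add_emod_eq {S N i j t : ℕ} (p : ℤ) (hj : j < S * N) :
    ((S : ℤ) * ((i + t) % N : ℕ) + p) % ((S * N : ℕ) : ℤ) = ((j + S * t % (S * N)) % (S * N) : ℕ) ↔
      ((S : ℤ) * i + p) % ((S * N : ℕ) : ℤ) = j := by
  have hj' : (j : ℤ) % ((S * N : ℕ) : ℤ) = j := by exact_mod_cast Nat.mod_eq_of_lt hj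
  have h1 : (S : ℤ) * ((i + t) % N : ℕ) ≡ S * i + S * t [ZMOD ((S * N : ℕ) : ℤ)] := by
    push_cast
    rw [← mul_add]
    exact (Int.mod_modEq ((i : ℤ) + t) N).mul_left'
  have h2 : (((j + S * t % (S * N)) % (S * N) : ℕ) : ℤ) = ((j : ℤ) + S * t) % ((S * N : ℕ) : ℤ) := by
    rw [Nat.add_mod_mod]
    push_cast
    rfl
  rw [h2]
  nth_rewrite 2 [← hj']
  change _ ≡ _ [ZMOD _] ↔ _ ≡ _ [ZMOD _]
  have h3 : (S : ℤ) * ((i + t) % N : ℕ) + p ≡ S * i + p + S * t [ZMOD ((S * N : ℕ) : ℤ)] := by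
    have := h1.add_right p
    rwa [add_right_comm] at this
  exact ⟨fun h => Int.ModEq.add_right_cancel' _ (h3.symm.trans h),
    fun h => h3.trans (h.add_right _)⟩

theorem layerMatrix_submatrix_shift {d M C k S N : ℕ} [NeZero N] [NeZero (S * N)]
    (K : Kernel d M C k) (t : Fin d → Fin N) :
    (layerMatrix S N K).submatrix (outShift M t) (inShift C S t) = layerMatrix S N K := by
  ext ⟨m, i⟩ ⟨c, j⟩
  simp only [Matrix.submatrix_apply, layerMatrix, Matrix.of_apply, outShift, inShift,
    Equiv.prodCongr_apply, Prod.map, Equiv.refl_apply, Equiv.coe_addRight, Pi.add_apply,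
    Fin.val_add, Fin.val_ofNat, add_sub_assoc]
  refine Finset.sum_congr rfl fun p _ => if_congr (forall_congr' fun a => ?_) rfl rfl
  exact emod_eq_iff_add_emod_eq _ (j a).2

/-- The residual `A Aᵀ - 1` is invariant under the permutations that preserve `A`. -/
theorem mul_transpose_sub_one_apply_equiv {m n : Type*} [Fintype n] [DecidableEq m]
    {A : Matrix m n ℝ} {e : m ≃ m} {f : n ≃ n} (h : A.submatrix e f = A) (i j : m) :
    (A * A.transpose - 1 : Matrix m m ℝ) (e i) (e j) = (A * A.transpose - 1 : Matrix m m ℝ) i j := by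
  have h1 : (A * A.transpose - 1).submatrix e e = A * A.transpose - 1 := by
    rw [Matrix.submatrix_sub, Pi.sub_apply, Pi.sub_apply, ← Matrix.submatrix_mul_equiv _ _ e f e,
      ← Matrix.transpose_submatrix, h, Matrix.submatrix_one_equiv]
  exact congrFun (congrFun h1 i) j

/-- The residual of the row-orthogonality case. -/
def residual {d M C k : ℕ} (S N : ℕ) (K : Kernel d M C k) :
    Matrix (Fin M × (Fin d → Fin N)) (Fin M × (Fin d → Fin N)) ℝ :=
  layerMatrix S N K * (layerMatrix S N K).transpose - 1

/-- The residual of the column-orthogonality case. -/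
def coresidual {d M C k : ℕ} (S N : ℕ) (K : Kernel d M C k) :
    Matrix (Fin C × (Fin d → Fin (S * N))) (Fin C × (Fin d → Fin (S * N))) ℝ :=
  (layerMatrix S N K).transpose * layerMatrix S N K - 1

theorem residual_isSymm {d M C k : ℕ} (S N : ℕ) (K : Kernel d M C k) :
    (residual S N K).IsSymm :=
  isSymm_mul_transpose_sub_one _

theorem coresidual_isSymm {d M C k : ℕ} (S N : ℕ) (K : Kernel d M C k) :
    (coresidual S N K).IsSymm := by
  simpa [coresidual] using isSymm_mul_transpose_sub_one (layerMatrix S N K).transpose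

theorem residual_shift {d M C k S N : ℕ} [NeZero N] [NeZero (S * N)] (K : Kernel d M C k)
    (t : Fin d → Fin N) (x y : Fin M × (Fin d → Fin N)) :
    residual S N K (outShift M t x) (outShift M t y) = residual S N K x y :=
  mul_transpose_sub_one_apply_equiv (layerMatrix_submatrix_shift K t) x y

theorem coresidual_shift {d M C k S N : ℕ} [NeZero N] [NeZero (S * N)] (K : Kernel d M C k)
    (t : Fin d → Fin N) (x y : Fin C × (Fin d → Fin (S * N))) :
    coresidual S N K (inShift C S t x) (inShift C S t y) = coresidual S N K x y := by
  have h := congrArg Matrix.transpose (layerMatrix_submatrix_shift (S := S) K t)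
  rw [Matrix.transpose_submatrix] at h
  simpa [coresidual] using mul_transpose_sub_one_apply_equiv h x y

/-! ### The central columns of the row residual -/

/-- The output position `(q, …, q)` with `q = ⌊(k - 1) / S⌋`. -/
def center {d : ℕ} (k S : ℕ) {N : ℕ} (hq : (k - 1) / S < N) : Fin d → Fin N :=
  fun _ => ⟨(k - 1) / S, hq⟩

theorem two_mul_padding_div {k S : ℕ} (hS : 0 < S) :
    2 * padding k S / S = 2 * ((k - 1) / S) := by
  rw [padding, ← mul_assoc, Nat.mul_div_cancel _ hS]

theorem two_mul_div_lt {k S N : ℕ} (hk : 0 < k) (hSN : 2 * k - 1 ≤ S * N) :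
    2 * ((k - 1) / S) < N := by
  by_contra! h
  have h1 : S * N ≤ S * (2 * ((k - 1) / S)) := Nat.mul_le_mul_left _ h
  have h2 := Nat.mul_div_le (k - 1) S
  rw [mul_left_comm] at h1
  omega

/-- Relative to the position `q`, congruence modulo `S N` of two tap positions is equality: their
difference lies strictly between `- S N` and `S N`. -/
theorem emod_tap_eq_iff {k S N i p p' : ℕ} (r : ℤ) (hS : 0 < S) (hSN : 2 * k - 1 ≤ S * N)
    (hi : i < N) (hp : p < k) (hp' : p' < k) :
    (((S : ℤ) * ((k - 1) / S : ℕ) + p' - r) % ((S * N : ℕ) : ℤ)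
        = ((S : ℤ) * i + p - r) % ((S * N : ℕ) : ℤ)) ↔ padding k S + p' = S * i + p := by
  have hP : (S : ℤ) * ((k - 1) / S : ℕ) = (padding k S : ℕ) := by
    rw [padding]
    push_cast
    ring
  have hP1 : padding k S ≤ k - 1 := Nat.div_mul_le_self _ _
  have hP2 : k - 1 < padding k S + S := Nat.lt_div_mul_add hS
  have hi' : S * i + S ≤ S * N := by
    rw [← Nat.mul_succ]
    exact Nat.mul_le_mul_left _ hi
  have hSi : (S : ℤ) * i = ((S * i : ℕ) : ℤ) := by push_cast; rfl
  rw [hP, hSi]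
  constructor
  · intro h
    have hd := Int.eq_zero_of_abs_lt_dvd (Int.ModEq.dvd h) (by rw [abs_lt]; omega)
    omega
  · intro h
    congr 2
    exact_mod_cast h

/-- In the column at `(q, …, q)` of `A Aᵀ` no product of taps wraps around the boundary, so the
entries are plain zero-padded correlations, at every output position `i`. -/
theorem layerMatrix_gram_apply {d M C k S N : ℕ} (hS : 0 < S) (hk : 0 < k)
    (hSN : 2 * k - 1 ≤ S * N) (hq : (k - 1) / S < N) (K : Kernel d M C k) (m l : Fin M)
    (i : Fin d → Fin N) :
    (layerMatrix S N K * (layerMatrix S N K).transpose) (m, i) (l, center k S hq)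
      = ∑ c, ∑ p : Fin d → Fin k, K m c p *
          zeroPad (padding k S) (K l c) (fun a => S * (i a : ℕ) + (p a : ℕ)) := by
  have hpos : 0 < S * N := by omega
  -- The row `(l, (q, …, q))` of the layer matrix, as a function on all integer positions.
  have h := layerMatrix_mulVec hpos K (fun c z => ∑ p' : Fin d → Fin k,
    if ∀ a, ((S : ℤ) * ((k - 1) / S : ℕ) + (p' a : ℕ) - ((k - 1) / 2 : ℕ)) % ((S * N : ℕ) : ℤ)
      = z a then K l c p' else 0) m i
  refine Eq.trans ?_ (h.trans ?_)
  · rfl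
  · refine Finset.sum_congr rfl fun c _ => Finset.sum_congr rfl fun p _ => ?_
    congr 1
    simp only [fun (p' : Fin d → Fin k) a =>
      emod_tap_eq_iff ((k - 1) / 2 : ℕ) hS hSN (i a).2 (p a).2 (p' a).2]
    simp only [zeroPad]
    split_ifs with hc
    · rw [Finset.sum_eq_single fun a => ⟨S * i a + p a - padding k S, by have := hc a; omega⟩]
      · rw [if_pos fun a => ?_]
        have := hc a
        dsimp only
        omega
      · intro p' _ hp'
        refine if_neg fun h' => hp' (funext fun a => Fin.ext ?_)
        have := h' a
        dsimp only
        omega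
      · simp
    · refine Finset.sum_eq_zero fun p' _ => if_neg fun h' => hc fun a => ?_
      have := h' a
      have := (p' a).2
      omega

/-- The inclusion of the index set of `CONV(K, K)` into the output positions. -/
def tapEmb {d k S N : ℕ} (h : 2 * padding k S / S < N) (i : Fin d → Fin (2 * padding k S / S + 1)) :
    Fin d → Fin N :=
  fun a => Fin.castLE h (i a)

theorem tapEmb_injective {d k S N : ℕ} (h : 2 * padding k S / S < N) :
    Function.Injective (tapEmb (d := d) h) := fun _ _ hij =>
  funext fun a => Fin.castLE_injective h (congrFun hij a)

theorem residual_tapEmb {d M C k S N : ℕ} (hS : 0 < S) (hk : 0 < k)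
    (hSN : 2 * k - 1 ≤ S * N) (hq : (k - 1) / S < N) (h : 2 * padding k S / S < N)
    (K : Kernel d M C k) (m l : Fin M) (i : Fin d → Fin (2 * padding k S / S + 1)) :
    residual S N K (m, tapEmb h i) (l, center k S hq)
      = convTensor (padding k S) S K m l i - idTensor M (padding k S) S m l i := by
  rw [residual, Matrix.sub_apply, layerMatrix_gram_apply hS hk hSN hq]
  congr 1
  have hP : padding k S / S = (k - 1) / S := by rw [padding, Nat.mul_div_cancel _ hS]
  rw [Matrix.one_apply, idTensor]
  refine if_congr ?_ rfl rfl
  simp only [Prod.mk.injEq, funext_iff, Fin.ext_iff, tapEmb, center, Fin.val_castLE, hP]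

/-- Outside `⟦0, 2 q⟧^d` the translated kernels no longer overlap. -/
theorem residual_center_eq_zero {d M C k S N : ℕ} (hS : 0 < S) (hk : 0 < k)
    (hSN : 2 * k - 1 ≤ S * N) (hq : (k - 1) / S < N) (h : 2 * padding k S / S < N)
    (K : Kernel d M C k) (m l : Fin M) {i : Fin d → Fin N} (hi : i ∉ Set.range (tapEmb h)) :
    residual S N K (m, i) (l, center k S hq) = 0 := by
  have hex : ∃ a, 2 * ((k - 1) / S) < i a := by
    by_contra! hle
    rw [← two_mul_padding_div hS] at hle
    exact hi ⟨fun a => ⟨i a, Nat.lt_succ_of_le (hle a)⟩, rfl⟩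
  obtain ⟨a, ha⟩ := hex
  have hne : ¬(m = l ∧ i = center k S hq) := by
    rintro ⟨-, rfl⟩
    simp only [center] at ha
    omega
  rw [residual, Matrix.sub_apply, layerMatrix_gram_apply hS hk hSN hq, Matrix.one_apply,
    if_neg (by simpa using hne), sub_zero]
  refine Finset.sum_eq_zero fun c _ => Finset.sum_eq_zero fun p _ => ?_
  rw [zeroPad, dif_neg, mul_zero]
  intro hc
  have hca := (hc a).2
  have h1 : S * (2 * ((k - 1) / S) + 1) ≤ S * i a := Nat.mul_le_mul_left _ ha
  have h2 : k - 1 < padding k S + S := Nat.lt_div_mul_add hS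
  have h3 : S * (2 * ((k - 1) / S) + 1) = 2 * padding k S + S := by
    rw [padding]
    ring
  omega

theorem sum_residual_sq {d M C k S N : ℕ} (hS : 0 < S) (hk : 0 < k)
    (hSN : 2 * k - 1 ≤ S * N) (hq : (k - 1) / S < N) (K : Kernel d M C k) (l : Fin M) :
    ∑ x, residual S N K x (l, center k S hq) ^ 2
      = ∑ m, ∑ i, (convTensor (padding k S) S K m l i - idTensor M (padding k S) S m l i) ^ 2 := by
  have h : 2 * padding k S / S < N := by
    rw [two_mul_padding_div hS]
    exact two_mul_div_lt hk hSN
  rw [Fintype.sum_prod_type]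
  refine Finset.sum_congr rfl fun m _ => ?_
  refine (Fintype.sum_of_injective (tapEmb h) (tapEmb_injective h) _ _ (fun i hi => ?_)
    fun i => ?_).symm
  · rw [residual_center_eq_zero hS hk hSN hq h K m l hi, sq, zero_mul]
  · rw [residual_tapEmb hS hk hSN hq h]

theorem sum_sum_residual_sq {d M C k S N : ℕ} (hS : 0 < S) (hk : 0 < k)
    (hSN : 2 * k - 1 ≤ S * N) (hq : (k - 1) / S < N) (K : Kernel d M C k) :
    ∑ l, ∑ x, residual S N K x (l, center k S hq) ^ 2 = LorthRO S K := by
  simp only [sum_residual_sq hS hk hSN hq]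
  exact Finset.sum_comm

theorem card_residual_ne_zero {d M C k S N : ℕ} (hS : 0 < S) (hk : 0 < k)
    (hSN : 2 * k - 1 ≤ S * N) (hq : (k - 1) / S < N) (K : Kernel d M C k) (l : Fin M) :
    (Finset.univ.filter fun x => residual S N K x (l, center k S hq) ≠ 0).card
      ≤ (2 * ((k - 1) / S) + 1) ^ d * M := by
  have h : 2 * padding k S / S < N := by
    rw [two_mul_padding_div hS]
    exact two_mul_div_lt hk hSN
  calc _ ≤ (Finset.univ.image fun x : Fin M × (Fin d → Fin (2 * padding k S / S + 1)) =>
        (x.1, tapEmb h x.2)).card := by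
        refine Finset.card_le_card fun x hx => ?_
        obtain ⟨m, i⟩ := x
        by_contra hni
        refine (Finset.mem_filter.1 hx).2
          (residual_center_eq_zero hS hk hSN hq h K m l fun ⟨j, hj⟩ => hni ?_)
        exact Finset.mem_image.2 ⟨(m, j), Finset.mem_univ _, by rw [← hj]⟩
    _ ≤ (Finset.univ : Finset (Fin M × (Fin d → Fin (2 * padding k S / S + 1)))).card :=
        Finset.card_image_le
    _ = (2 * ((k - 1) / S) + 1) ^ d * M := by
        rw [two_mul_padding_div hS]
        simp [mul_comm]

/-! ### The support of the column residual -/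

/-- A non-zero entry of `Aᵀ A - 1` joins two input positions that differ modulo `S N` by a
difference of two taps of the kernel. -/
theorem exists_tap_sub_of_coresidual_ne_zero {d M C k S N : ℕ} (hk : 0 < k)
    {K : Kernel d M C k} {x y : Fin C × (Fin d → Fin (S * N))}
    (h : coresidual S N K x y ≠ 0) :
    ∃ p p' : Fin d → Fin k, ∀ a,
      ((x.2 a : ℕ) : ℤ) = ((y.2 a : ℕ) + (p a : ℕ) - (p' a : ℕ)) % ((S * N : ℕ) : ℤ) := by
  have hmod : ∀ z : Fin (S * N), ((z : ℕ) : ℤ) % ((S * N : ℕ) : ℤ) = (z : ℕ) := fun z => by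
    exact_mod_cast Nat.mod_eq_of_lt z.2
  by_cases hxy : x = y
  · subst hxy
    refine ⟨fun _ => ⟨0, hk⟩, fun _ => ⟨0, hk⟩, fun a => ?_⟩
    rw [add_sub_cancel_right, hmod]
  rw [coresidual, Matrix.sub_apply, Matrix.one_apply_ne hxy, sub_zero, Matrix.mul_apply] at h
  obtain ⟨z, -, hz⟩ := Finset.exists_ne_zero_of_sum_ne_zero h
  obtain ⟨p, -, hp⟩ := Finset.exists_ne_zero_of_sum_ne_zero (left_ne_zero_of_mul hz)
  obtain ⟨p', -, hp'⟩ := Finset.exists_ne_zero_of_sum_ne_zero (right_ne_zero_of_mul hz)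
  have hp1 := (ite_ne_right_iff.1 hp).1
  have hp2 := (ite_ne_right_iff.1 hp').1
  refine ⟨p, p', fun a => ?_⟩
  rw [← hp1 a, ← hp2 a, add_sub_assoc _ ((p a : ℕ) : ℤ) ((p' a : ℕ) : ℤ), Int.emod_add_emod]
  congr 1
  ring

theorem card_coresidual_ne_zero {d M C k S N : ℕ} [NeZero (S * N)] (hk : 0 < k)
    (K : Kernel d M C k) (y : Fin C × (Fin d → Fin (S * N))) :
    (Finset.univ.filter fun x => coresidual S N K x y ≠ 0).card ≤ (2 * k - 1) ^ d * C := by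
  -- Such an `x` is determined by its channel and the differences of taps, shifted by `k - 1`.
  have hle : (Finset.univ.filter fun x => coresidual S N K x y ≠ 0).card
      ≤ (Finset.univ : Finset (Fin C × (Fin d → Fin (2 * k - 1)))).card := by
    refine Finset.card_le_card_of_surjOn (fun w => (w.1, fun a => Fin.ofNat (S * N)
      (((y.2 a : ℕ) + (w.2 a : ℕ) - ((k - 1 : ℕ) : ℤ)) % ((S * N : ℕ) : ℤ)).toNat)) ?_
    intro x hx
    obtain ⟨p, p', hpp⟩ := exists_tap_sub_of_coresidual_ne_zero hk (Finset.mem_filter.1 hx).2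
    refine ⟨(x.1, fun a => ⟨p a + (k - 1) - p' a, by omega⟩), Finset.mem_coe.2 (Finset.mem_univ _),
      Prod.ext rfl (funext fun a => Fin.ext ?_)⟩
    have h1 : ((y.2 a : ℕ) : ℤ) + ((p a + (k - 1) - p' a : ℕ) : ℤ) - ((k - 1 : ℕ) : ℤ)
        = (y.2 a : ℕ) + (p a : ℕ) - (p' a : ℕ) := by
      have := (p' a).2
      omega
    simp only [Fin.val_ofNat]
    rw [h1, ← hpp a, Int.toNat_natCast, Nat.mod_eq_of_lt (x.2 a).2]
  refine hle.trans (le_of_eq ?_)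
  simp [mul_comm]

/-! ### All columns, by translation -/

theorem eq_outShift_center {d M k S N : ℕ} [NeZero N] (hq : (k - 1) / S < N)
    (l : Fin M) (j : Fin d → Fin N) :
    (l, j) = outShift M (j - center k S hq) (l, center k S hq) := by
  simp [outShift]

theorem inShift_injective {d C S N : ℕ} [NeZero (S * N)] (hS : 0 < S)
    (y : Fin C × (Fin d → Fin (S * N))) :
    Function.Injective fun t : Fin d → Fin N => inShift C S t y := by
  intro t t' h
  funext a
  have h1 : y.2 a + Fin.ofNat (S * N) (S * (t a : ℕ))
      = y.2 a + Fin.ofNat (S * N) (S * (t' a : ℕ)) := congrFun (congrArg Prod.snd h) a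
  have h2 := congrArg Fin.val (add_left_cancel h1)
  have hlt : ∀ u : Fin N, S * (u : ℕ) < S * N := fun u => Nat.mul_lt_mul_of_pos_left u.2 hS
  rw [Fin.val_ofNat, Fin.val_ofNat, Nat.mod_eq_of_lt (hlt _), Nat.mod_eq_of_lt (hlt _)] at h2
  exact Fin.ext (Nat.eq_of_mul_eq_mul_left hS h2)

section Columns

variable {d M C k S N : ℕ} [NeZero N] [NeZero (S * N)]

theorem sum_residual_sq_outShift (K : Kernel d M C k) (t : Fin d → Fin N)
    (y : Fin M × (Fin d → Fin N)) :
    ∑ x, residual S N K x (outShift M t y) ^ 2 = ∑ x, residual S N K x y ^ 2 := by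
  rw [← Equiv.sum_comp (outShift M t)]
  simp only [residual_shift]

theorem card_residual_outShift (K : Kernel d M C k) (t : Fin d → Fin N)
    (y : Fin M × (Fin d → Fin N)) :
    (Finset.univ.filter fun x => residual S N K x (outShift M t y) ≠ 0).card
      = (Finset.univ.filter fun x => residual S N K x y ≠ 0).card := by
  refine (Finset.card_equiv (outShift M t) fun x => ?_).symm
  simp [residual_shift]

theorem sum_coresidual_sq_inShift (K : Kernel d M C k) (t : Fin d → Fin N)
    (y : Fin C × (Fin d → Fin (S * N))) :
    ∑ x, coresidual S N K x (inShift C S t y) ^ 2 = ∑ x, coresidual S N K x y ^ 2 := by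
  rw [← Equiv.sum_comp (inShift C S t)]
  simp only [coresidual_shift]

/-- `‖A Aᵀ - 1‖_F² = N ^ d · LorthRO`. -/
theorem sum_residual_sq_eq (hS : 0 < S) (hk : 0 < k) (hSN : 2 * k - 1 ≤ S * N)
    (hq : (k - 1) / S < N) (K : Kernel d M C k) :
    ∑ y, ∑ x, residual S N K x y ^ 2 = (N : ℝ) ^ d * LorthRO S K := by
  rw [Fintype.sum_prod_type, ← sum_sum_residual_sq hS hk hSN hq, Finset.mul_sum]
  refine Finset.sum_congr rfl fun l _ => ?_
  have h : ∀ j : Fin d → Fin N, ∑ x, residual S N K x (l, j) ^ 2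
      = ∑ x, residual S N K x (l, center k S hq) ^ 2 := fun j => by
    rw [eq_outShift_center hq l j, sum_residual_sq_outShift]
  simp [h]

/-- `‖Aᵀ A - 1‖_F² = N ^ d · LorthCO`. -/
theorem sum_coresidual_sq_eq (hS : 0 < S) (hk : 0 < k) (hSN : 2 * k - 1 ≤ S * N)
    (hq : (k - 1) / S < N) (K : Kernel d M C k) :
    ∑ y, ∑ x, coresidual S N K x y ^ 2 = (N : ℝ) ^ d * LorthCO S K := by
  have h := sum_sq_transpose_mul_sub_one (layerMatrix S N K)
  rw [← residual, sum_residual_sq_eq hS hk hSN hq, ← coresidual] at h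
  rw [h, LorthCO]
  simp only [Fintype.card_prod, Fintype.card_fun, Fintype.card_fin]
  push_cast
  ring

theorem sum_residual_sq_le (hS : 0 < S) (hk : 0 < k) (hSN : 2 * k - 1 ≤ S * N)
    (hq : (k - 1) / S < N) (K : Kernel d M C k) (y : Fin M × (Fin d → Fin N)) :
    ∑ x, residual S N K x y ^ 2 ≤ LorthRO S K := by
  obtain ⟨l, j⟩ := y
  rw [eq_outShift_center hq l j, sum_residual_sq_outShift, ← sum_sum_residual_sq hS hk hSN hq]
  exact Finset.single_le_sum
    (f := fun l => ∑ x, residual S N K x (l, center k S hq) ^ 2)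
    (fun _ _ => Finset.sum_nonneg fun _ _ => sq_nonneg _) (Finset.mem_univ l)

theorem sum_coresidual_sq_le (hS : 0 < S) (hk : 0 < k) (hSN : 2 * k - 1 ≤ S * N)
    (hq : (k - 1) / S < N) (K : Kernel d M C k) (y : Fin C × (Fin d → Fin (S * N))) :
    ∑ x, coresidual S N K x y ^ 2 ≤ LorthCO S K := by
  have hN : (0 : ℝ) < (N : ℝ) ^ d := pow_pos (Nat.cast_pos.2 (Nat.pos_of_neZero N)) d
  refine le_of_mul_le_mul_left ?_ hN
  rw [← sum_coresidual_sq_eq hS hk hSN hq]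
  calc (N : ℝ) ^ d * ∑ x, coresidual S N K x y ^ 2
      = ∑ t : Fin d → Fin N, ∑ x, coresidual S N K x (inShift C S t y) ^ 2 := by
        simp [sum_coresidual_sq_inShift]
    _ = ∑ z ∈ Finset.univ.image fun t : Fin d → Fin N => inShift C S t y,
          ∑ x, coresidual S N K x z ^ 2 := by
        rw [Finset.sum_image fun t _ t' _ h => inShift_injective hS y h]
    _ ≤ ∑ z, ∑ x, coresidual S N K x z ^ 2 :=
        Finset.sum_le_sum_of_subset_of_nonneg (Finset.subset_univ _)
          fun _ _ _ => Finset.sum_nonneg fun _ _ => sq_nonneg _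

end Columns

end ConvOrth

/-! ### The two-sided bounds -/

theorem theorem3 {d M C k S N : ℕ} (hd : d = 1 ∨ d = 2) (hM : 0 < M) (hC : 0 < C)
    (hk : Odd k) (hSN : 2 * k - 1 ≤ S * N) (K : ConvOrth.Kernel d M C k) :
    (M ≤ C * S ^ d →
      1 / min (M : ℝ) ((C : ℝ) * (S : ℝ) ^ 2) * ConvOrth.LorthRO S K
          ≤ ConvOrth.errSpecRO S N K ^ 2 ∧
        ConvOrth.errSpecRO S N K ^ 2
          ≤ (2 * (((k - 1) / S : ℕ) : ℝ) + 1) ^ d * (M : ℝ) * ConvOrth.LorthRO S K) ∧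
    (C * S ^ d ≤ M →
      1 / min (M : ℝ) ((C : ℝ) * (S : ℝ) ^ 2) * ConvOrth.LorthCO S K
          ≤ ConvOrth.errSpecCO S N K ^ 2 ∧
        ConvOrth.errSpecCO S N K ^ 2
          ≤ (2 * (k : ℝ) - 1) ^ d * (C : ℝ) * ConvOrth.LorthCO S K) := by
  have hkpos : 0 < k := hk.pos
  have hpos : 0 < S * N := by omega
  have hS : 0 < S := Nat.pos_of_mul_pos_right hpos
  have hN : 0 < N := Nat.pos_of_mul_pos_left hpos
  have : NeZero N := ⟨hN.ne'⟩
  have : NeZero (S * N) := ⟨hpos.ne'⟩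
  have hq : (k - 1) / S < N := by
    have := ConvOrth.two_mul_div_lt hkpos hSN
    omega
  -- The constants are stated with `S ^ 2` for both dimensions; only `S ^ d ≤ S ^ 2` is needed.
  have hSd : (S : ℝ) ^ d ≤ (S : ℝ) ^ 2 :=
    pow_le_pow_right₀ (by exact_mod_cast hS) (by omega)
  have hCS : (C : ℝ) * (S : ℝ) ^ d ≤ (C : ℝ) * (S : ℝ) ^ 2 := by gcongr
  have hMR : (0 : ℝ) < M := by exact_mod_cast hM
  have hCR : (0 : ℝ) < (C : ℝ) * (S : ℝ) ^ d := by positivity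
  have hRO : 0 ≤ ConvOrth.LorthRO S K :=
    Finset.sum_nonneg fun _ _ => Finset.sum_nonneg fun _ _ => Finset.sum_nonneg fun _ _ =>
      sq_nonneg _
  refine ⟨fun hle => ⟨?_, ?_⟩, fun hle => ⟨?_, ?_⟩⟩
  · have hle' : (M : ℝ) ≤ (C : ℝ) * (S : ℝ) ^ d := by exact_mod_cast hle
    rw [min_eq_left (hle'.trans hCS), one_div_mul_eq_div, div_le_iff₀' hMR,
      ← ConvOrth.sum_sum_residual_sq hS hkpos hSN hq]
    refine (Finset.sum_le_sum fun l _ => ConvOrth.sum_sq_col_le_specNorm_sq _ _).trans_eq ?_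
    simp [ConvOrth.errSpecRO, ConvOrth.residual]
  · have h := ConvOrth.specNorm_sq_le (ConvOrth.residual_isSymm S N K) hRO
      (s := (2 * ((k - 1) / S) + 1) ^ d * M)
      (fun y => by
        obtain ⟨l, j⟩ := y
        rw [ConvOrth.eq_outShift_center hq l j, ConvOrth.card_residual_outShift]
        exact ConvOrth.card_residual_ne_zero hS hkpos hSN hq K l)
      (ConvOrth.sum_residual_sq_le hS hkpos hSN hq K)
    push_cast at h
    exact h
  · have hle' : (C : ℝ) * (S : ℝ) ^ d ≤ M := by exact_mod_cast hle
    have hmin : (C : ℝ) * (S : ℝ) ^ d ≤ min (M : ℝ) ((C : ℝ) * (S : ℝ) ^ 2) := le_min hle' hCS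
    rw [one_div_mul_eq_div, div_le_iff₀' (hCR.trans_le hmin)]
    refine le_trans ?_ (mul_le_mul_of_nonneg_right hmin (sq_nonneg _))
    have hNd : (0 : ℝ) < (N : ℝ) ^ d := by positivity
    refine le_of_mul_le_mul_left ?_ hNd
    rw [← ConvOrth.sum_coresidual_sq_eq hS hkpos hSN hq]
    refine (Finset.sum_le_sum fun y _ => ConvOrth.sum_sq_col_le_specNorm_sq _ _).trans_eq ?_
    simp only [Finset.sum_const, Finset.card_univ, Fintype.card_prod, Fintype.card_fun,
      Fintype.card_fin, nsmul_eq_mul, ConvOrth.errSpecCO, ConvOrth.coresidual]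
    push_cast
    ring
  · -- `LorthCO` is non-negative because it bounds the squared norm of a column.
    have y : Fin C × (Fin d → Fin (S * N)) := (⟨0, hC⟩, 0)
    have hCO : 0 ≤ ConvOrth.LorthCO S K :=
      (Finset.sum_nonneg fun _ _ => sq_nonneg _).trans
        (ConvOrth.sum_coresidual_sq_le hS hkpos hSN hq K y)
    have h := ConvOrth.specNorm_sq_le (ConvOrth.coresidual_isSymm S N K) hCO
      (ConvOrth.card_coresidual_ne_zero hkpos K)
      (ConvOrth.sum_coresidual_sq_le hS hkpos hSN hq K)
    rw [Nat.cast_mul, Nat.cast_pow, Nat.cast_sub (by omega)] at h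
    push_cast at h
    exact h
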